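/- Let $q$ be a complex number with $|q|<1$. Then the series on the left below converges absolutely, the continued fraction on the right converges, and $$ \sum_{n=0}^{\infty}(-1)^n q^{n(3n+2)}\left(1+q^{2n+1}\right) =\cfrac{1}{1-q+\cfrac{q^2-q^3}{1-q^3+\cfrac{q^4-q^2}{1-q^5+\cfrac{q^6-q^9}{1-q^7+\cfrac{q^8-q^4}{1-q^9+\cfrac{q^{10}-q^{15}}{1-q^{11}+\cfrac{q^{12}-q^{6}}{1-q^{13}+\cdots}}}}}}}. $$ Explicitly, the right side is the continued fraction $\dfrac{a_0}{b_0+}\,\dfrac{a_1}{b_1+}\,\dfrac{a_2}{b_2+}\cdots$ with $b_m=1-q^{2m+1}$ for $m\ge 0$, $a_0=1$, $a_m=q^{2m}-q^{3m}$ for odd $m\ge 1$, and $a_m=q^{2m}-q^{m}$ for even $m\ge 2$. Its approximants are the points $A_n/B_n$ of the Riemann sphere $\mathbb{C}\cup\{\infty\}$ (equal to $\infty$ when $B_n=0$), where $A_0=0$, $B_0=1$, $A_1=a_0$, $B_1=b_0$, and $X_{n+1}=b_nX_n+a_nX_{n-1}$ for $n\ge 1$ and $X\in\{A,B\}$; convergence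 means that the approximants converge in $\mathbb{C}\cup\{\infty\}$ to the finite number on the left. -/

import Mathlib

open Filter Topology

noncomputable section

/-- The continued fraction `b₀ + a 0 / (b 0 + a 1 / (b 1 + a 2 / (b 2 + ⋯)))`
with infinitely many partial numerators and denominators. -/
def cfrac (b₀ : ℂ) (a b : ℕ → ℂ) : GenContFract ℂ where
  h := b₀
  s := Stream'.Seq.ofStream (fun n => ⟨a n, b n⟩)

/-- The `n`-th approximant of a continued fraction, a point of the Riemann sphere. -/
def approximant (g : GenContFract ℂ) (n : ℕ) : OnePoint ℂ :=
  open Classical in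
  if g.dens n = 0 then OnePoint.infty else ((g.nums n / g.dens n : ℂ) : OnePoint ℂ)

/-- A continued fraction converges to the complex number `f` if its approximants converge to `f`
in the Riemann sphere. -/
def ConvergesTo (g : GenContFract ℂ) (f : ℂ) : Prop :=
  Tendsto (approximant g) atTop (𝓝 (f : OnePoint ℂ))

/-- The partial numerators `1, q² - q³, q⁴ - q², q⁶ - q⁹, q⁸ - q⁴, q¹⁰ - q¹⁵, q¹² - q⁶, …`. -/
def partialNum (q : ℂ) (m : ℕ) : ℂ :=
  if m = 0 then 1
  else if Odd m then q ^ (2 * m) - q ^ (3 * m)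
  else q ^ (2 * m) - q ^ m

/-- The partial denominators `1 - q, 1 - q³, 1 - q⁵, …`. -/
def partialDen (q : ℂ) (m : ℕ) : ℂ :=
  1 - q ^ (2 * m + 1)

end

/-! With p = q², let G_m be the ₁φ₁ series `tailSeries q m`. Two contiguous relations of Heine type,
used alternately, give G_m - G_{m+1} = a_{m+1}/(b_m b_{m+1}) G_{m+2}, the recurrence of the
continued fraction run backwards. Pairing G with a forward solution X yields a quantity that is
multiplied by b_{n+1} at each step; since G_m → 1 and a_m → 0, X_n/(b_0⋯b_{n-1}) converges to a
limit fixed by the initial data. For the denominators this limit is G_0 = 1, for the numerators it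
is G_1/(1-q), so the fraction converges to the latter. Independently, iterating a limiting
Rogers–Fine equation expands G_1/(1-q) into the false theta series. -/

/-- The finite `q`-shifted factorial `(x; p)_n = ∏_{i < n} (1 - x p ^ i)`. -/
noncomputable def qPoch (p x : ℂ) (n : ℕ) : ℂ := ∏ i ∈ Finset.range n, (1 - x * p ^ i)

/-- The power `p ^ (n (n - 1) / 2)`. -/
noncomputable def triPow (p : ℂ) (n : ℕ) : ℂ := ∏ i ∈ Finset.range n, p ^ i

/-- The `n`-th term of the confluent basic hypergeometric series `₁φ₁(b; c; p, z)`. -/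
noncomputable def qphiTerm (p b c z : ℂ) (n : ℕ) : ℂ :=
  (-z) ^ n * triPow p n * qPoch p b n / (qPoch p c n * qPoch p p n)

/-- The confluent basic hypergeometric series `₁φ₁(b; c; p, z)`. -/
noncomputable def qphi (p b c z : ℂ) : ℂ := ∑' n, qphiTerm p b c z n

/-! ### Shifted factorials -/

lemma qPoch_zero (p x : ℂ) : qPoch p x 0 = 1 := by simp [qPoch]

lemma qPoch_succ (p x : ℂ) (n : ℕ) : qPoch p x (n + 1) = qPoch p x n * (1 - x * p ^ n) := by
  simp [qPoch, Finset.prod_range_succ]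

lemma qPoch_succ' (p x : ℂ) (n : ℕ) : qPoch p x (n + 1) = (1 - x) * qPoch p (x * p) n := by
  simp only [qPoch, Finset.prod_range_succ', pow_zero, mul_one]
  rw [mul_comm]
  congr 1
  refine Finset.prod_congr rfl fun i _ => ?_
  ring

lemma triPow_succ (p : ℂ) (n : ℕ) : triPow p (n + 1) = triPow p n * p ^ n := by
  simp [triPow, Finset.prod_range_succ]

lemma one_sub_ne_zero_of_norm_lt {x : ℂ} (hx : ‖x‖ < 1) : 1 - x ≠ 0 := by
  intro h
  rw [← sub_eq_zero.mp h] at hx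
  simp at hx

lemma norm_mul_pow_lt_one {p x : ℂ} (hp : ‖p‖ < 1) (hx : ‖x‖ < 1) (n : ℕ) :
    ‖x * p ^ n‖ < 1 := by
  rw [norm_mul, norm_pow]
  exact (mul_le_of_le_one_right (norm_nonneg _) (pow_le_one₀ (norm_nonneg _) hp.le)).trans_lt hx

lemma qPoch_ne_zero {p x : ℂ} (hp : ‖p‖ < 1) (hx : ‖x‖ < 1) (n : ℕ) : qPoch p x n ≠ 0 :=
  Finset.prod_ne_zero_iff.mpr fun i _ =>
    one_sub_ne_zero_of_norm_lt (norm_mul_pow_lt_one hp hx i)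

lemma qphiTerm_zero (p b c z : ℂ) : qphiTerm p b c z 0 = 1 := by
  simp [qphiTerm, qPoch, triPow]

/-! ### Contiguous relations, term by term -/

/-- Over a common denominator the difference acquires the factor 1 - p^(n+1), which cancels the last
factor of (p; p)_{n+1} and so lowers the index to n. The odd relation works the same way. -/
lemma qphiTerm_heine_even {p b c z : ℂ} (hp : ‖p‖ < 1) (hc : ‖c‖ < 1) (n : ℕ) :
    qphiTerm p b c z (n + 1) - qphiTerm p (b * p) (c * p) z (n + 1) =
      z * (b - c) / ((1 - c) * (1 - c * p)) * qphiTerm p (b * p) (c * p * p) (z * p) n := by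
  have hc1 : ‖c * p‖ < 1 := by simpa using norm_mul_pow_lt_one hp hc 1
  have hc2 : ‖c * p * p‖ < 1 := by simpa using norm_mul_pow_lt_one hp hc1 1
  have e1 := one_sub_ne_zero_of_norm_lt hc
  have e2 := one_sub_ne_zero_of_norm_lt hc1
  have e3 := qPoch_ne_zero hp hc2 n
  have e4 := qPoch_ne_zero hp hp n
  have e5 := one_sub_ne_zero_of_norm_lt (norm_mul_pow_lt_one hp hp n)
  have e6 := one_sub_ne_zero_of_norm_lt (norm_mul_pow_lt_one hp hc1 n)
  have hs : qPoch p (c * p) n * (1 - c * p * p ^ n) = (1 - c * p) * qPoch p (c * p * p) n := by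
    rw [← qPoch_succ, qPoch_succ']
  have hs' : qPoch p (c * p) n = (1 - c * p) * qPoch p (c * p * p) n / (1 - c * p * p ^ n) :=
    eq_div_of_mul_eq e6 hs
  simp only [qphiTerm]
  rw [qPoch_succ' p b, qPoch_succ p (b * p), qPoch_succ' p c, hs', qPoch_succ' p (c * p),
    qPoch_succ p p, triPow_succ,
    show (-(z * p)) ^ n = (-z) ^ n * p ^ n by rw [← mul_pow, neg_mul]]
  clear hs hs'
  generalize qPoch p (c * p * p) n = C, qPoch p p n = D, p ^ n = y at *
  have e5' : 1 - y * p ≠ 0 := mul_comm p y ▸ e5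
  field_simp
  ring

lemma qphiTerm_heine_odd {p b c z : ℂ} (hp : ‖p‖ < 1) (hc : ‖c‖ < 1) (n : ℕ) :
    qphiTerm p b c z (n + 1) - qphiTerm p b (c * p) (z * p) (n + 1) =
      -(z * (1 - b)) / ((1 - c) * (1 - c * p)) *
        qphiTerm p (b * p) (c * p * p) (z * p) n := by
  have hc1 : ‖c * p‖ < 1 := by simpa using norm_mul_pow_lt_one hp hc 1
  have hc2 : ‖c * p * p‖ < 1 := by simpa using norm_mul_pow_lt_one hp hc1 1
  have e1 := one_sub_ne_zero_of_norm_lt hc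
  have e2 := one_sub_ne_zero_of_norm_lt hc1
  have e3 := qPoch_ne_zero hp hc2 n
  have e4 := qPoch_ne_zero hp hp n
  have e5 := one_sub_ne_zero_of_norm_lt (norm_mul_pow_lt_one hp hp n)
  have e6 := one_sub_ne_zero_of_norm_lt (norm_mul_pow_lt_one hp hc1 n)
  have hs : qPoch p (c * p) n * (1 - c * p * p ^ n) = (1 - c * p) * qPoch p (c * p * p) n := by
    rw [← qPoch_succ, qPoch_succ']
  have hs' : qPoch p (c * p) n = (1 - c * p) * qPoch p (c * p * p) n / (1 - c * p * p ^ n) :=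
    eq_div_of_mul_eq e6 hs
  simp only [qphiTerm]
  rw [qPoch_succ' p b, qPoch_succ' p c, hs', qPoch_succ' p (c * p),
    qPoch_succ p p, triPow_succ, pow_succ (-(z * p)),
    show (-(z * p)) ^ n = (-z) ^ n * p ^ n by rw [← mul_pow, neg_mul]]
  clear hs hs'
  generalize qPoch p (c * p * p) n = C, qPoch p p n = D, p ^ n = y at *
  have e5' : 1 - y * p ≠ 0 := mul_comm p y ▸ e5
  field_simp
  ring

/-! ### Uniform bounds and summed contiguous relations -/

/-- A majorant of the terms of `qphi`, up to the power of `z`. -/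
noncomputable def majorant (r : ℝ) (p : ℂ) (n : ℕ) : ℝ := (2 / (1 - r) ^ 2) ^ n * ‖triPow p n‖

lemma summable_majorant (r : ℝ) {p : ℂ} (hp : ‖p‖ < 1) : Summable (majorant r p) := by
  have hlim : Tendsto (fun n : ℕ => 2 / (1 - r) ^ 2 * ‖p‖ ^ n) atTop (𝓝 0) := by
    simpa using (tendsto_pow_atTop_nhds_zero_of_lt_one (norm_nonneg p) hp).const_mul
      (2 / (1 - r) ^ 2)
  refine summable_of_ratio_norm_eventually_le (r := 1 / 2) (by norm_num) ?_
  filter_upwards [hlim.eventually_le_const (show (0 : ℝ) < 1 / 2 by norm_num)] with n hn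
  have h : majorant r p (n + 1) = 2 / (1 - r) ^ 2 * ‖p‖ ^ n * majorant r p n := by
    simp only [majorant, triPow_succ, norm_mul, norm_pow]
    ring
  rw [h, norm_mul]
  refine mul_le_mul_of_nonneg_right ?_ (norm_nonneg _)
  rwa [Real.norm_of_nonneg (by positivity)]

lemma norm_qPoch_le {p x : ℂ} (hp : ‖p‖ ≤ 1) (hx : ‖x‖ ≤ 1) (n : ℕ) :
    ‖qPoch p x n‖ ≤ 2 ^ n := by
  induction n with
  | zero => simp [qPoch_zero]
  | succ n ih =>
    rw [qPoch_succ, norm_mul, pow_succ]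
    gcongr
    refine (norm_sub_le _ _).trans ?_
    have : ‖x * p ^ n‖ ≤ 1 := by
      rw [norm_mul, norm_pow]
      exact mul_le_one₀ hx (by positivity) (pow_le_one₀ (norm_nonneg _) hp)
    rw [norm_one]
    linarith

lemma le_norm_qPoch {r : ℝ} {p x : ℂ} (hr : r < 1) (hp : ‖p‖ ≤ 1) (hx : ‖x‖ ≤ r) (n : ℕ) :
    (1 - r) ^ n ≤ ‖qPoch p x n‖ := by
  induction n with
  | zero => simp [qPoch_zero]
  | succ n ih =>
    rw [qPoch_succ, norm_mul, pow_succ]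
    have h1 : ‖x * p ^ n‖ ≤ r := by
      rw [norm_mul, norm_pow]
      exact (mul_le_of_le_one_right (norm_nonneg _) (pow_le_one₀ (norm_nonneg _) hp)).trans hx
    have h2 : 1 - r ≤ ‖1 - x * p ^ n‖ := by
      have := norm_sub_norm_le 1 (x * p ^ n)
      rw [norm_one] at this
      linarith
    exact mul_le_mul ih h2 (by linarith) (norm_nonneg _)

lemma norm_qphiTerm_le {r : ℝ} {p b c z : ℂ} (hr : r < 1) (hp : ‖p‖ ≤ r) (hb : ‖b‖ ≤ 1)
    (hc : ‖c‖ ≤ r) (n : ℕ) : ‖qphiTerm p b c z n‖ ≤ ‖z‖ ^ n * majorant r p n := by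
  have h1 := norm_qPoch_le (hp.trans hr.le) hb n
  have h2 := le_norm_qPoch hr (hp.trans hr.le) hc n
  have h3 := le_norm_qPoch hr (hp.trans hr.le) hp n
  have h0 : 0 < (1 - r) ^ n := pow_pos (by linarith) n
  simp only [qphiTerm, majorant, norm_div, norm_mul, norm_pow, norm_neg]
  calc _ ≤ ‖z‖ ^ n * ‖triPow p n‖ * 2 ^ n / ((1 - r) ^ n * (1 - r) ^ n) := by gcongr
    _ = _ := by rw [div_pow, ← pow_mul, two_mul, pow_add]; ring

lemma summable_qphiTerm {r : ℝ} {p b c z : ℂ} (hr : r < 1) (hp : ‖p‖ ≤ r) (hb : ‖b‖ ≤ 1)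
    (hc : ‖c‖ ≤ r) (hz : ‖z‖ ≤ 1) : Summable (qphiTerm p b c z) := by
  refine Summable.of_norm_bounded (summable_majorant r (hp.trans_lt hr)) fun n => ?_
  refine (norm_qphiTerm_le hr hp hb hc n).trans ?_
  exact mul_le_of_le_one_left (by unfold majorant; positivity)
    (pow_le_one₀ (norm_nonneg _) hz)

lemma qphi_eq_one_add {r : ℝ} {p b c z : ℂ} (hr : r < 1) (hp : ‖p‖ ≤ r) (hb : ‖b‖ ≤ 1)
    (hc : ‖c‖ ≤ r) (hz : ‖z‖ ≤ 1) :
    qphi p b c z = 1 + ∑' n, qphiTerm p b c z (n + 1) := by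
  rw [qphi, (summable_qphiTerm hr hp hb hc hz).tsum_eq_zero_add, qphiTerm_zero]

/-- Every term past the first carries a factor z. The bound is uniform in b and c, so it serves both
for the limit of the tails and for the Rogers–Fine remainder. -/
lemma norm_qphi_sub_one_le {r : ℝ} {p b c z : ℂ} (hr : r < 1) (hp : ‖p‖ ≤ r) (hb : ‖b‖ ≤ 1)
    (hc : ‖c‖ ≤ r) (hz : ‖z‖ ≤ 1) :
    ‖qphi p b c z - 1‖ ≤ ‖z‖ * ∑' n, majorant r p (n + 1) := by
  rw [qphi_eq_one_add hr hp hb hc hz, add_sub_cancel_left, ← tsum_mul_left]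
  have hs := (summable_nat_add_iff 1).mpr (summable_majorant r (hp.trans_lt hr))
  refine tsum_of_norm_bounded (hs.mul_left ‖z‖).hasSum fun n => ?_
  refine (norm_qphiTerm_le hr hp hb hc (n + 1)).trans ?_
  refine mul_le_mul_of_nonneg_right ?_ (by unfold majorant; positivity)
  exact pow_le_of_le_one (norm_nonneg _) hz (by simp)

lemma qphi_heine_even {r : ℝ} {p b c z : ℂ} (hr : r < 1) (hp : ‖p‖ ≤ r) (hb : ‖b‖ ≤ 1)
    (hc : ‖c‖ ≤ r) (hz : ‖z‖ ≤ 1) :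
    qphi p b c z - qphi p (b * p) (c * p) z =
      z * (b - c) / ((1 - c) * (1 - c * p)) * qphi p (b * p) (c * p * p) (z * p) := by
  have hp1 := hp.trans_lt hr
  have hb' : ‖b * p‖ ≤ 1 := by
    rw [norm_mul]; exact mul_le_one₀ hb (norm_nonneg _) hp1.le
  have hc' : ‖c * p‖ ≤ r := by
    rw [norm_mul]; exact (mul_le_of_le_one_right (norm_nonneg _) hp1.le).trans hc
  rw [qphi_eq_one_add hr hp hb hc hz, qphi_eq_one_add hr hp hb' hc' hz, add_sub_add_left_eq_sub,
    ← Summable.tsum_sub ((summable_nat_add_iff 1).mpr (summable_qphiTerm hr hp hb hc hz))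
      ((summable_nat_add_iff 1).mpr (summable_qphiTerm hr hp hb' hc' hz)), qphi, ← tsum_mul_left]
  exact tsum_congr fun n => qphiTerm_heine_even hp1 (hc.trans_lt hr) n

lemma qphi_heine_odd {r : ℝ} {p b c z : ℂ} (hr : r < 1) (hp : ‖p‖ ≤ r) (hb : ‖b‖ ≤ 1)
    (hc : ‖c‖ ≤ r) (hz : ‖z‖ ≤ 1) :
    qphi p b c z - qphi p b (c * p) (z * p) =
      -(z * (1 - b)) / ((1 - c) * (1 - c * p)) * qphi p (b * p) (c * p * p) (z * p) := by
  have hp1 := hp.trans_lt hr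
  have hz' : ‖z * p‖ ≤ 1 := by
    rw [norm_mul]; exact mul_le_one₀ hz (norm_nonneg _) hp1.le
  have hc' : ‖c * p‖ ≤ r := by
    rw [norm_mul]; exact (mul_le_of_le_one_right (norm_nonneg _) hp1.le).trans hc
  rw [qphi_eq_one_add hr hp hb hc hz, qphi_eq_one_add hr hp hb hc' hz', add_sub_add_left_eq_sub,
    ← Summable.tsum_sub ((summable_nat_add_iff 1).mpr (summable_qphiTerm hr hp hb hc hz))
      ((summable_nat_add_iff 1).mpr (summable_qphiTerm hr hp hb hc' hz')), qphi, ← tsum_mul_left]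
  exact tsum_congr fun n => qphiTerm_heine_odd hp1 (hc.trans_lt hr) n

/-! ### Rogers–Fine equation and the false theta series -/

/-- The right side telescopes, so summation leaves only (1 - x²)/(1 - x) = 1 + x. -/
lemma qphiTerm_rogersFine {p x : ℂ} (hp : ‖p‖ < 1) (hx : ‖x‖ < 1) (n : ℕ) :
    qphiTerm p p (x * p) (x ^ 2) n / (1 - x) +
        x ^ 3 * p * (qphiTerm p p (x * p * p) ((x * p) ^ 2) n / (1 - x * p)) =
      (1 - x ^ 2 * p ^ n) * (qphiTerm p p (x * p) (x ^ 2) n / (1 - x)) -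
        (1 - x ^ 2 * p ^ (n + 1)) * (qphiTerm p p (x * p) (x ^ 2) (n + 1) / (1 - x)) := by
  have hx1 : ‖x * p‖ < 1 := by simpa using norm_mul_pow_lt_one hp hx 1
  have hx2 : ‖x * p * p‖ < 1 := by simpa using norm_mul_pow_lt_one hp hx1 1
  have e1 := one_sub_ne_zero_of_norm_lt hx
  have e2 := one_sub_ne_zero_of_norm_lt hx1
  have e3 := qPoch_ne_zero hp hx2 n
  have e4 := qPoch_ne_zero hp hp n
  have e5 := one_sub_ne_zero_of_norm_lt (norm_mul_pow_lt_one hp hp n)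
  have e6 := one_sub_ne_zero_of_norm_lt (norm_mul_pow_lt_one hp hx1 n)
  have hs : qPoch p (x * p) n * (1 - x * p * p ^ n) = (1 - x * p) * qPoch p (x * p * p) n := by
    rw [← qPoch_succ, qPoch_succ']
  have hs' : qPoch p (x * p) n = (1 - x * p) * qPoch p (x * p * p) n / (1 - x * p * p ^ n) :=
    eq_div_of_mul_eq e6 hs
  simp only [qphiTerm]
  rw [qPoch_succ' p (x * p), hs', qPoch_succ p p, triPow_succ]
  field_simp
  ring

/-- The `α → ∞` case of the Rogers–Fine functional equation. -/
lemma qphi_rogersFine {p x : ℂ} (hp : ‖p‖ < 1) (hx : ‖x‖ < 1) :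
    qphi p p (x * p) (x ^ 2) / (1 - x) =
      1 + x - x ^ 3 * p * (qphi p p (x * p * p) ((x * p) ^ 2) / (1 - x * p)) := by
  have hx1 : ‖x * p‖ < 1 := by simpa using norm_mul_pow_lt_one hp hx 1
  have hx2 : ‖x * p * p‖ < 1 := by simpa using norm_mul_pow_lt_one hp hx1 1
  have hsq : ∀ {y : ℂ}, ‖y‖ < 1 → ‖y ^ 2‖ ≤ 1 := fun hy => by
    rw [norm_pow]; exact pow_le_one₀ (norm_nonneg _) hy.le
  have s1 : Summable (fun n => qphiTerm p p (x * p) (x ^ 2) n / (1 - x)) :=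
    (summable_qphiTerm (max_lt hp hx1) (le_max_left _ _) hp.le (le_max_right _ _)
      (hsq hx)).div_const _
  have s2 : Summable (fun n => qphiTerm p p (x * p * p) ((x * p) ^ 2) n / (1 - x * p)) :=
    (summable_qphiTerm (max_lt hp hx2) (le_max_left _ _) hp.le (le_max_right _ _)
      (hsq hx1)).div_const _
  have s3 : Summable
      (fun n => (1 - x ^ 2 * p ^ n) * (qphiTerm p p (x * p) (x ^ 2) n / (1 - x))) := by
    refine Summable.of_norm_bounded (s1.norm.mul_left 2) fun n => ?_
    rw [norm_mul]
    refine mul_le_mul_of_nonneg_right ?_ (norm_nonneg _)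
    refine (norm_sub_le _ _).trans ?_
    have : ‖x ^ 2 * p ^ n‖ ≤ 1 := by
      rw [norm_mul, norm_pow p]
      exact mul_le_one₀ (hsq hx) (by positivity) (pow_le_one₀ (norm_nonneg _) hp.le)
    rw [norm_one]
    linarith
  have h := tsum_congr (L := .unconditional ℕ) (qphiTerm_rogersFine hp hx)
  rw [Summable.tsum_add s1 (s2.mul_left _), Summable.tsum_sub s3 ((summable_nat_add_iff 1).mpr s3),
    tsum_mul_left, s3.tsum_eq_zero_add, tsum_div_const, tsum_div_const, qphiTerm_zero,
    add_sub_cancel_right, pow_zero] at h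
  have e1 := one_sub_ne_zero_of_norm_lt hx
  have h' : (1 - x ^ 2 * 1) * (1 / (1 - x)) = 1 + x := by field_simp; ring
  rw [h'] at h
  exact eq_sub_of_add_eq h

/-- Rogers' false theta series as a `₁φ₁`. -/
lemma tsum_falseTheta {q : ℂ} (hq : ‖q‖ < 1) :
    Summable (fun n : ℕ => (-1 : ℂ) ^ n * q ^ (n * (3 * n + 2)) * (1 + q ^ (2 * n + 1))) ∧
    ∑' n : ℕ, (-1 : ℂ) ^ n * q ^ (n * (3 * n + 2)) * (1 + q ^ (2 * n + 1)) =
      qphi (q ^ 2) (q ^ 2) (q * q ^ 2) (q ^ 2) / (1 - q) := by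
  have hqp : ∀ n : ℕ, ‖q ^ (n + 1)‖ ≤ ‖q‖ := fun n => by
    rw [norm_pow]; exact pow_le_of_le_one (norm_nonneg _) hq.le (by simp)
  have hle : ∀ n : ℕ, ‖q ^ n‖ ≤ 1 := fun n => by
    rw [norm_pow]; exact pow_le_one₀ (norm_nonneg _) hq.le
  have hs : Summable
      (fun n : ℕ => (-1 : ℂ) ^ n * q ^ (n * (3 * n + 2)) * (1 + q ^ (2 * n + 1))) := by
    refine Summable.of_norm_bounded
      ((summable_geometric_of_lt_one (norm_nonneg q) hq).mul_right 2) fun n => ?_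
    rw [norm_mul, norm_mul, norm_pow, norm_neg, norm_one, one_pow, one_mul, norm_pow]
    refine mul_le_mul (pow_le_pow_of_le_one (norm_nonneg _) hq.le (by nlinarith)) ?_
      (norm_nonneg _) (by positivity)
    refine (norm_add_le _ _).trans ?_
    have := hle (2 * n + 1)
    rw [norm_one]
    linarith
  refine ⟨hs, ?_⟩
  -- The Rogers–Fine function in base q² at x = q^(2k+1). One step multiplies by -x³q² = -q^(6k+5),
  -- and N steps by (-1)^N q^(N(3N+2)).
  set h : ℕ → ℂ := fun k =>
    qphi (q ^ 2) (q ^ 2) (q ^ (2 * k + 1) * q ^ 2) ((q ^ (2 * k + 1)) ^ 2) /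
      (1 - q ^ (2 * k + 1)) with hh
  have hrec : ∀ k, h k = 1 + q ^ (2 * k + 1) - q ^ (6 * k + 5) * h (k + 1) := fun k => by
    have := qphi_rogersFine ((hqp 1).trans_lt hq) ((hqp (2 * k)).trans_lt hq)
    simp only [hh]
    rw [this, show q ^ (2 * (k + 1) + 1) = q ^ (2 * k + 1) * q ^ 2 by ring]
    ring
  have hpart : ∀ N, ∑ n ∈ Finset.range N,
      (-1 : ℂ) ^ n * q ^ (n * (3 * n + 2)) * (1 + q ^ (2 * n + 1)) =
        h 0 - (-1) ^ N * q ^ (N * (3 * N + 2)) * h N := fun N => by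
    induction N with
    | zero => simp
    | succ N ih =>
      rw [Finset.sum_range_succ, ih, hrec N]
      ring
  obtain ⟨C, hC⟩ : ∃ C, ∀ k, ‖h k‖ ≤ C := by
    refine ⟨(1 + ∑' n, majorant ‖q‖ (q ^ 2) (n + 1)) / (1 - ‖q‖), fun k => ?_⟩
    have hc : ‖q ^ (2 * k + 1) * q ^ 2‖ ≤ ‖q‖ := by
      rw [← pow_add]; exact hqp _
    have hz : ‖(q ^ (2 * k + 1)) ^ 2‖ ≤ 1 := by rw [← pow_mul]; exact hle _
    have h1 := norm_qphi_sub_one_le hq (hqp 1) (hle 2) hc hz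
    have hM : 0 ≤ ∑' n, majorant ‖q‖ (q ^ 2) (n + 1) :=
      tsum_nonneg fun n => by unfold majorant; positivity
    have h2 := norm_sub_norm_le (qphi (q ^ 2) (q ^ 2) (q ^ (2 * k + 1) * q ^ 2)
      ((q ^ (2 * k + 1)) ^ 2)) 1
    have h3 := norm_sub_norm_le 1 (q ^ (2 * k + 1))
    have h4 := hqp (2 * k)
    have h5 := mul_le_of_le_one_left hM hz
    rw [norm_one] at h2 h3
    simp only [hh, norm_div]
    exact div_le_div₀ (by linarith) (by linarith) (by linarith) (by linarith)
  have hlim : Tendsto (fun N => h 0 - (-1) ^ N * q ^ (N * (3 * N + 2)) * h N) atTop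
      (𝓝 (h 0 - 0)) := by
    refine Tendsto.sub tendsto_const_nhds (squeeze_zero_norm (a := fun N => ‖q‖ ^ N * C)
      (fun N => ?_) ?_)
    · rw [norm_mul, norm_mul, norm_pow, norm_neg, norm_one, one_pow, one_mul, norm_pow]
      exact mul_le_mul (pow_le_pow_of_le_one (norm_nonneg _) hq.le (by nlinarith)) (hC N)
        (norm_nonneg _) (by positivity)
    · simpa using (tendsto_pow_atTop_nhds_zero_of_lt_one (norm_nonneg q) hq).mul_const C
  have := tendsto_nhds_unique hs.hasSum.tendsto_sum_nat (hlim.congr fun N => (hpart N).symm)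
  rw [this]
  simp [hh]

/-! ### Tails of the continued fraction -/

/-- The auxiliary series whose consecutive ratios are the tails of the continued fraction. -/
noncomputable def tailSeries (q : ℂ) (m : ℕ) : ℂ :=
  qphi (q ^ 2) ((q ^ 2) ^ ((m + 1) / 2)) (q * (q ^ 2) ^ m) ((q ^ 2) ^ (m / 2 + 1))

lemma tailSeries_recurrence {q : ℂ} (hq : ‖q‖ < 1) (m : ℕ) :
    tailSeries q m - tailSeries q (m + 1) =
      partialNum q (m + 1) / (partialDen q m * partialDen q (m + 1)) * tailSeries q (m + 2) := by
  have hp : ‖q ^ 2‖ ≤ ‖q‖ := by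
    rw [norm_pow]; exact pow_le_of_le_one (norm_nonneg _) hq.le (by simp)
  have hle : ∀ n : ℕ, ‖(q ^ 2) ^ n‖ ≤ 1 := fun n => by
    rw [← pow_mul, norm_pow]; exact pow_le_one₀ (norm_nonneg _) hq.le
  have hc : ‖q * (q ^ 2) ^ m‖ ≤ ‖q‖ := by
    rw [norm_mul]; exact mul_le_of_le_one_right (norm_nonneg _) (hle m)
  have hd : (1 - q * (q ^ 2) ^ m) * (1 - q * (q ^ 2) ^ m * q ^ 2) =
      partialDen q m * partialDen q (m + 1) := by
    simp only [partialDen]; ring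
  -- From even m the index shift moves b and c; from odd m it moves c and z.
  obtain ⟨k, rfl | rfl⟩ := Nat.even_or_odd' m
  · have key := qphi_heine_even hq hp (hle k) hc (hle (k + 1))
    have hn : partialNum q (2 * k + 1) =
        (q ^ 2) ^ (k + 1) * ((q ^ 2) ^ k - q * (q ^ 2) ^ (2 * k)) := by
      rw [partialNum, if_neg (by omega), if_pos (odd_two_mul_add_one k)]; ring
    simp only [tailSeries]
    rw [show (2 * k + 1) / 2 = k by omega, show 2 * k / 2 = k by omega,
      show (2 * k + 1 + 1) / 2 = k + 1 by omega, show (2 * k + 2 + 1) / 2 = k + 1 by omega,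
      hn, ← hd]
    simp only [pow_succ (q ^ 2), ← mul_assoc] at key ⊢
    exact key
  · have key := qphi_heine_odd hq hp (hle (k + 1)) hc (hle (k + 1))
    have hn : partialNum q (2 * k + 1 + 1) =
        -((q ^ 2) ^ (k + 1) * (1 - (q ^ 2) ^ (k + 1))) := by
      rw [partialNum, if_neg (by omega), if_neg (by rw [Nat.not_odd_iff_even]; exact ⟨k + 1, by ring⟩)]
      ring
    simp only [tailSeries]
    rw [show (2 * k + 1) / 2 = k by omega,
      show (2 * k + 1 + 1) / 2 = k + 1 by omega, show (2 * k + 1 + 1 + 1) / 2 = k + 1 by omega,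
      show (2 * k + 1 + 2 + 1) / 2 = k + 2 by omega,
      hn, ← hd]
    simp only [pow_succ (q ^ 2), ← mul_assoc] at key ⊢
    exact key

/-- Here b = 1, and (1; p)_n vanishes for n ≥ 1. -/
lemma tailSeries_zero (q : ℂ) : tailSeries q 0 = 1 := by
  simp only [tailSeries, qphi]
  rw [tsum_eq_single 0, qphiTerm_zero]
  intro n hn
  obtain ⟨n, rfl⟩ := Nat.exists_eq_succ_of_ne_zero hn
  simp [qphiTerm, qPoch_succ']

lemma tendsto_tailSeries {q : ℂ} (hq : ‖q‖ < 1) : Tendsto (tailSeries q) atTop (𝓝 1) := by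
  have hle : ∀ n : ℕ, ‖(q ^ 2) ^ n‖ ≤ 1 := fun n => by
    rw [← pow_mul, norm_pow]; exact pow_le_one₀ (norm_nonneg _) hq.le
  have hp : ‖q ^ 2‖ ≤ ‖q‖ := by
    rw [norm_pow]; exact pow_le_of_le_one (norm_nonneg _) hq.le (by simp)
  rw [tendsto_iff_norm_sub_tendsto_zero]
  refine squeeze_zero (g := fun m => ‖q‖ ^ m * ∑' n, majorant ‖q‖ (q ^ 2) (n + 1))
    (fun _ => norm_nonneg _) (fun m => ?_) ?_
  · have hc : ‖q * (q ^ 2) ^ m‖ ≤ ‖q‖ := by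
      rw [norm_mul]; exact mul_le_of_le_one_right (norm_nonneg _) (hle m)
    refine (norm_qphi_sub_one_le hq hp (hle _) hc (hle _)).trans ?_
    refine mul_le_mul_of_nonneg_right ?_ (tsum_nonneg fun n => by unfold majorant; positivity)
    rw [← pow_mul, norm_pow]
    exact pow_le_pow_of_le_one (norm_nonneg _) hq.le (by omega)
  · simpa using (tendsto_pow_atTop_nhds_zero_of_lt_one (norm_nonneg q) hq).mul_const _

/-! ### Limits of solutions of the three-term recurrence -/

/-- A first-order linear recurrence with vanishing feedback has the obvious limit. -/
lemma tendsto_of_recurrence {D G c : ℕ → ℂ} {v : ℂ} (hG : Tendsto G atTop (𝓝 1))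
    (hc : Tendsto c atTop (𝓝 0)) (h : ∀ n, D (n + 1) * G n + D n * c n = v) :
    Tendsto D atTop (𝓝 v) := by
  have hG0 : ∀ᶠ n in atTop, G n ≠ 0 := hG.eventually_ne one_ne_zero
  have hvG : Tendsto (fun n => v / G n) atTop (𝓝 v) := by
    simpa [Pi.div_def] using (tendsto_const_nhds (x := v)).div hG one_ne_zero
  have hcG : Tendsto (fun n => c n / G n) atTop (𝓝 0) := by
    simpa [Pi.div_def] using hc.div hG one_ne_zero
  have hrec : ∀ᶠ n in atTop, D (n + 1) = v / G n - D n * (c n / G n) := by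
    filter_upwards [hG0] with n hn
    rw [← h n]
    field_simp
    ring
  obtain ⟨N, hN⟩ := eventually_atTop.mp ((hrec.and (hvG.norm.eventually_le_const
    (lt_add_one ‖v‖))).and (hcG.norm.eventually_le_const
      (show ‖(0 : ℂ)‖ < 1 / 2 by simp)))
  -- Chosen so that ‖v‖ + 1 + C/2 ≤ C, which closes the induction.
  set C := max ‖D N‖ (2 * (‖v‖ + 1)) with hC
  have hbd : ∀ n, N ≤ n → ‖D n‖ ≤ C := fun n hn => by
    induction n, hn using Nat.le_induction with
    | base => exact le_max_left _ _
    | succ n hn ih =>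
      obtain ⟨⟨h1, h2⟩, h3⟩ := hN n hn
      have h4 : 2 * (‖v‖ + 1) ≤ C := le_max_right _ _
      rw [h1]
      refine (norm_sub_le _ _).trans ?_
      rw [norm_mul]
      have := mul_le_mul ih h3 (norm_nonneg _) ((norm_nonneg _).trans ih)
      linarith
  have hz : Tendsto (fun n => D n * (c n / G n)) atTop (𝓝 0) := by
    refine squeeze_zero_norm' (a := fun n => C * ‖c n / G n‖) ?_ (by simpa using hcG.norm.const_mul C)
    filter_upwards [eventually_ge_atTop N] with n hn
    rw [norm_mul]
    exact mul_le_mul_of_nonneg_right (hbd n hn) (norm_nonneg _)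
  rw [← tendsto_add_atTop_iff_nat 1]
  have := hvG.sub hz
  rw [sub_zero] at this
  exact this.congr' (hrec.mono fun n hn => hn.symm)

/-- If `G` is a solution of the backward recurrence tending to `1`, every solution of the
three-term recurrence, divided by the product of the partial denominators, converges. -/
lemma tendsto_div_prod_of_recurrence {a b G X : ℕ → ℂ} (hb : ∀ n, b n ≠ 0)
    (hG : Tendsto G atTop (𝓝 1))
    (hc : Tendsto (fun n => a (n + 1) / (b n * b (n + 1))) atTop (𝓝 0))
    (hrec : ∀ m, G m - G (m + 1) = a (m + 1) / (b m * b (m + 1)) * G (m + 2))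
    (hX : ∀ n, X (n + 2) = b (n + 1) * X (n + 1) + a (n + 1) * X n) :
    Tendsto (fun n => X n / ∏ i ∈ Finset.range n, b i) atTop
      (𝓝 ((X 1 * G 1 + X 0 * (a 1 / b 1) * G 2) / b 0)) := by
  set v := (X 1 * G 1 + X 0 * (a 1 / b 1) * G 2) / b 0 with hv
  have hP : ∀ n, ∏ i ∈ Finset.range n, b i ≠ 0 := fun n =>
    Finset.prod_ne_zero_iff.mpr fun i _ => hb i
  -- The left side is a Casoratian-like pairing of X with G; passing from n to n + 1 multiplies it
  -- by b_{n+1}.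
  have inv : ∀ n, X (n + 1) * G (n + 1) + X n * (a (n + 1) / b (n + 1)) * G (n + 2) =
      v * ∏ i ∈ Finset.range (n + 1), b i := fun n => by
    induction n with
    | zero => rw [Finset.prod_range_one, hv, div_mul_cancel₀ _ (hb 0)]
    | succ n ih =>
      rw [Finset.prod_range_succ, ← mul_assoc, ← ih, hX n]
      have h := hrec (n + 1)
      have h1 := hb (n + 1)
      have h2 := hb (n + 2)
      have h3 : a (n + 2) / b (n + 2) * G (n + 3) = b (n + 1) * (G (n + 1) - G (n + 2)) := by
        rw [h]; field_simp
      rw [mul_assoc (X (n + 1)), h3]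
      field_simp
      ring
  refine tendsto_of_recurrence (G := fun n => G (n + 1))
    (c := fun n => a (n + 1) / (b n * b (n + 1)) * G (n + 2))
    ((tendsto_add_atTop_iff_nat 1).mpr hG) ?_ fun n => ?_
  · simpa using hc.mul ((tendsto_add_atTop_iff_nat 2).mpr hG)
  · have h := inv n
    rw [Finset.prod_range_succ] at h ⊢
    have h1 := hb n
    have h2 := hb (n + 1)
    have h3 := hP n
    rw [← mul_left_inj' (mul_ne_zero h3 h1), ← h]
    field_simp

/-! ### Convergence and value of the fraction -/

lemma cfrac_get? (b₀ : ℂ) (a b : ℕ → ℂ) (n : ℕ) :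
    (cfrac b₀ a b).s.get? n = some ⟨a n, b n⟩ := rfl

lemma tendsto_partialNum_div {q : ℂ} (hq : ‖q‖ < 1) :
    Tendsto (fun n => partialNum q (n + 1) / (partialDen q n * partialDen q (n + 1))) atTop
      (𝓝 0) := by
  have hpow : Tendsto (fun n : ℕ => ‖q‖ ^ n) atTop (𝓝 0) :=
    tendsto_pow_atTop_nhds_zero_of_lt_one (norm_nonneg q) hq
  have hnum : Tendsto (fun n => partialNum q n) atTop (𝓝 0) := by
    refine squeeze_zero_norm' (a := fun n => ‖q‖ ^ n * 2) ?_ (by simpa using hpow.mul_const 2)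
    filter_upwards [eventually_ne_atTop 0] with n hn
    have hk : ∀ j, n ≤ j → ‖q ^ j‖ ≤ ‖q‖ ^ n := fun j hj => by
      rw [norm_pow]; exact pow_le_pow_of_le_one (norm_nonneg _) hq.le hj
    have h1 := hk (2 * n) (by omega)
    rw [partialNum, if_neg hn]
    split_ifs
    · have h2 := hk (3 * n) (by omega)
      exact (norm_sub_le _ _).trans (by linarith)
    · have h2 := hk n le_rfl
      exact (norm_sub_le _ _).trans (by linarith)
  have hden : Tendsto (fun n => partialDen q n) atTop (𝓝 1) := by
    have h0 : Tendsto (fun n : ℕ => q ^ n) atTop (𝓝 0) :=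
      tendsto_pow_atTop_nhds_zero_of_norm_lt_one hq
    have h2 : Tendsto (fun n : ℕ => 2 * n + 1) atTop atTop :=
      tendsto_atTop_mono (fun n => by simp only [id]; omega) tendsto_id
    simpa [partialDen] using tendsto_const_nhds (x := (1 : ℂ)).sub (h0.comp h2)
  simpa [Pi.div_def] using ((tendsto_add_atTop_iff_nat 1).mpr hnum).div
    (hden.mul ((tendsto_add_atTop_iff_nat 1).mpr hden)) (by simp)

/-- Since `g.dens n / P n` tends to 1, only finitely many approximants can be ∞. -/
lemma convergesTo_of_tendsto {g : GenContFract ℂ} {P : ℕ → ℂ} {f : ℂ} (hP : ∀ n, P n ≠ 0)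
    (hn : Tendsto (fun n => g.nums n / P n) atTop (𝓝 f))
    (hd : Tendsto (fun n => g.dens n / P n) atTop (𝓝 1)) : ConvergesTo g f := by
  have hlim : Tendsto (fun n => g.nums n / g.dens n) atTop (𝓝 f) := by
    have := hn.div hd one_ne_zero
    rw [div_one] at this
    exact this.congr fun n => div_div_div_cancel_right₀ (hP n) _ _
  have hcoe : Tendsto (fun n => ((g.nums n / g.dens n : ℂ) : OnePoint ℂ)) atTop
      (𝓝 (f : OnePoint ℂ)) := (OnePoint.continuous_coe.tendsto f).comp hlim
  refine hcoe.congr' ?_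
  filter_upwards [hd.eventually_ne one_ne_zero] with n hn
  rw [approximant, if_neg]
  rintro h0
  simp [h0] at hn

theorem mainTheorem11 (q : ℂ) (hq : ‖q‖ < 1) :
    Summable (fun n : ℕ => (-1 : ℂ) ^ n * q ^ (n * (3 * n + 2)) * (1 + q ^ (2 * n + 1))) ∧
      ConvergesTo (cfrac 0 (partialNum q) (partialDen q))
        (∑' n : ℕ, (-1 : ℂ) ^ n * q ^ (n * (3 * n + 2)) * (1 + q ^ (2 * n + 1))) := by
  obtain ⟨hs, hval⟩ := tsum_falseTheta hq
  refine ⟨hs, ?_⟩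
  rw [hval]
  set g := cfrac 0 (partialNum q) (partialDen q) with hg
  have hb : ∀ n, partialDen q n ≠ 0 := fun n => one_sub_ne_zero_of_norm_lt (by
    rw [norm_pow]; exact pow_lt_one₀ (norm_nonneg _) hq (by simp))
  have hget : ∀ n, g.s.get? n = some ⟨partialNum q n, partialDen q n⟩ := cfrac_get? _ _ _
  have hnum := tendsto_div_prod_of_recurrence (X := g.nums) hb (tendsto_tailSeries hq)
    (tendsto_partialNum_div hq) (tailSeries_recurrence hq)
    fun n => GenContFract.nums_recurrence (hget (n + 1)) rfl rfl
  have hden := tendsto_div_prod_of_recurrence (X := g.dens) hb (tendsto_tailSeries hq)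
    (tendsto_partialNum_div hq) (tailSeries_recurrence hq)
    fun n => GenContFract.dens_recurrence (hget (n + 1)) rfl rfl
  have hA0 : g.nums 0 = 0 := by simp [hg, cfrac]
  have hB0 : g.dens 0 = 1 := by simp
  have hA1 : g.nums 1 = 1 := by
    rw [GenContFract.first_num_eq (hget 0)]; simp [hg, cfrac, partialNum]
  have hB1 : g.dens 1 = partialDen q 0 := GenContFract.first_den_eq (hget 0)
  refine convergesTo_of_tendsto (P := fun n => ∏ i ∈ Finset.range n, partialDen q i)
    (fun n => Finset.prod_ne_zero_iff.mpr fun i _ => hb i) ?_ ?_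
  · convert hnum using 2
    rw [hA0, hA1]
    simp [tailSeries, partialDen]
  · convert hden using 2
    -- The recurrence at m = 0 identifies the limit for the denominators with G_0 = 1.
    have h := tailSeries_recurrence hq 0
    have h0 := hb 0
    have h1 := hb 1
    rw [tailSeries_zero, zero_add, zero_add] at h
    have h' : partialNum q 1 / partialDen q 1 * tailSeries q 2 =
        partialDen q 0 * (1 - tailSeries q 1) := by
      rw [h]; field_simp
    rw [hB0, hB1, one_mul, h', eq_div_iff h0]
    ring
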